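/- Let $R$ be a regular local ring, let $N \ge 1$ be an integer, and let $J \subset R$ be an ideal of height $N-1$ that can be generated by $N$ elements. Let $\mathbf z = z_1,\ldots,z_{N-1}$ be a maximal regular sequence in $J$, and assume $J \neq (\mathbf z)$ (which is automatic when $J$ cannot be generated by fewer than $N$ elements). Write $\operatorname{pd}$ for projective dimension over $R$ and $(\mathbf z):J=\{r\in R : rJ\subseteq(\mathbf z)\}$. Then \[ \operatorname{pd}(R/J) \;\le\; \operatorname{pd}\bigl(R/((\mathbf z):J)\bigr) + 1 . \] Equality holds if and only if $R/J$ is not Cohen–Macaulay, and $R/J$ is not Cohen–Macaulay if and only if $\operatorname{pd}(R/J)\ge N$. -/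

import Mathlib

/-- `z` is a maximal regular sequence in the ideal `J`: it is an `R`-regular sequence of elements
of `J`, and it cannot be prolonged by an element of `J` to a longer `R`-regular sequence. -/
structure IsMaximalRegularSequenceIn {R : Type*} [CommRing R] (J : Ideal R) (z : List R) :
    Prop where
  isRegular : RingTheory.Sequence.IsRegular R z
  mem : ∀ x ∈ z, x ∈ J
  maximal : ∀ x ∈ J, ¬ RingTheory.Sequence.IsRegular R (z ++ [x])

/-- The depth of a nonzero finitely generated module `M` over a Noetherian local ring `R`: the
supremum of the lengths of the `M`-regular sequences in the maximal ideal of `R`. -/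
noncomputable def localDepth (R : Type*) [CommRing R] [IsLocalRing R]
    (M : Type*) [AddCommGroup M] [Module R M] : ℕ∞ :=
  ⨆ (s : List R) (_ : RingTheory.Sequence.IsRegular M s ∧
    ∀ x ∈ s, x ∈ IsLocalRing.maximalIdeal R), (s.length : ℕ∞)

/-- A nonzero finitely generated module `M` over a Noetherian local ring `R` is Cohen-Macaulay if
its depth equals its Krull dimension (the dimension of its support). For `M = R ⧸ J` with `J` a
proper ideal this is the Cohen-Macaulay property of the local ring `R ⧸ J`. -/
def IsCohenMacaulayModule (R : Type*) [CommRing R] [IsLocalRing R]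
    (M : Type*) [AddCommGroup M] [Module R M] : Prop :=
  (localDepth R M : WithBot ℕ∞) = Module.supportDim R M

open RingTheory.Sequence IsLocalRing Pointwise CategoryTheory

universe u

/-! Let d = dim R, p = pd R/J and q = pd R/((z):J); both are finite. The core is an equivalence,
`hasProjectiveDimensionLT_quotient_iff_colon`: for n ≥ N - 1, p < n + 2 iff q < n + 1. If J = (z) +
(f), it is read off from 0 → R/((z):f) → R/(z) → R/J → 0, because pd R/(z) = N - 1. In general z is
traded, one element at a time, for a regular sequence v with J = (v) + (f)
(`exists_isRegular_sup_span_singleton_eq`). One trade replaces a by b, both in J and regular on R/K,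
where K is generated by the remaining elements. In R/K the images of b·((K,a):J) and a·((K,b):J)
coincide, so R/((K,a):J) and R/((K,b):J) are quotients of R/K by isomorphic submodules, and bounds
on projective dimension above pd R/K transfer. Auslander–Buchsbaum for cyclic modules, together with
depth ≤ d - (N - 1) for proper quotients of R/(z), gives p, q ≥ N - 1. Maximality of z gives dim R/J
= d - (N - 1), so R/J is Cohen–Macaulay iff p = N - 1. In that case p ≤ q; otherwise p ≥ N and the
equivalence forces p = q + 1. -/

/-- Prime avoidance for cosets: if no prime of a finite set contains both `x` and `I`, then some
element of `x + I` avoids all of them. -/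
theorem Ideal.exists_add_notMem_of_forall_not_sup_le {R : Type*} [CommRing R]
    (s : Finset (Ideal R)) (hs : ∀ P ∈ s, P.IsPrime) (x : R) (I : Ideal R)
    (h : ∀ P ∈ s, ¬ (Ideal.span {x} ⊔ I ≤ P)) :
    ∃ y ∈ I, ∀ P ∈ s, x + y ∉ P := by
  classical
  induction hn : s.card generalizing s with
  | zero =>
    rw [Finset.card_eq_zero] at hn
    exact ⟨0, I.zero_mem, by simp [hn]⟩
  | succ n ih =>
    -- Minimality ensures that no other member of `s` lies inside `P`, so some element of `I` in all
    -- the others avoids `P` and can correct `y`.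
    obtain ⟨P, hP⟩ := s.exists_minimal (Finset.card_pos.mp (by omega))
    have hPs := hP.prop
    obtain ⟨y, hy, hyQ⟩ := ih (s.erase P) (fun Q hQ ↦ hs Q (Finset.mem_of_mem_erase hQ))
      (fun Q hQ ↦ h Q (Finset.mem_of_mem_erase hQ)) (by simp [Finset.card_erase_of_mem hPs, hn])
    by_cases hyP : x + y ∈ P
    · have hIP : ¬ (I ⊓ (s.erase P).inf id ≤ P) := by
        intro hle
        rcases (hs P hPs).inf_le.mp hle with hle | hle
        · refine h P hPs (sup_le ?_ hle)
          rw [Ideal.span_singleton_le_iff_mem]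
          exact (Ideal.add_mem_iff_left P (hle hy)).mp hyP
        · obtain ⟨Q, hQ, hQP⟩ := ((hs P hPs).inf_le' (f := id)).mp hle
          rw [Finset.mem_erase] at hQ
          exact hQ.1 (le_antisymm hQP (hP.le_of_le hQ.2 hQP))
      obtain ⟨t, ht, htP⟩ := SetLike.not_le_iff_exists.mp hIP
      refine ⟨y + t, I.add_mem hy ht.1, fun Q hQ ↦ ?_⟩
      rw [← add_assoc]
      by_cases hQP : Q = P
      · subst hQP
        exact fun hmem ↦ htP ((Ideal.add_mem_iff_right Q hyP).mp hmem)
      · have hQ' : Q ∈ s.erase P := Finset.mem_erase.mpr ⟨hQP, hQ⟩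
        have htQ : t ∈ Q := Finset.inf_le (f := id) hQ' ht.2
        exact fun hmem ↦ hyQ Q hQ' ((Ideal.add_mem_iff_left Q htQ).mp hmem)
    · refine ⟨y, hy, fun Q hQ ↦ ?_⟩
      by_cases hQP : Q = P
      · rwa [hQP]
      · exact hyQ Q (Finset.mem_erase.mpr ⟨hQP, hQ⟩)

/-! ### Regular systems of parameters -/

/-- A Noetherian local ring is a domain if it has a prime principal ideal whose generator avoids
all minimal primes. -/
theorem IsLocalRing.isDomain_of_isPrime_span_singleton {R : Type*} [CommRing R] [IsLocalRing R]
    [IsNoetherianRing R] (x : R) (hx : (Ideal.span {x}).IsPrime)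
    (hmin : ∀ P ∈ minimalPrimes R, x ∉ P) : IsDomain R := by
  obtain ⟨P, hP, hPx⟩ := Ideal.exists_minimalPrimes_le (bot_le : (⊥ : Ideal R) ≤ Ideal.span {x})
  have hPp : P.IsPrime := hP.1.1
  -- A minimal prime P below (x) misses x, so P = xP, and Nakayama gives P = 0.
  have hle : P ≤ Ideal.span {x} • P := by
    intro y hy
    obtain ⟨a, rfl⟩ := Ideal.mem_span_singleton'.mp (hPx hy)
    have ha : a ∈ P := (hPp.mem_or_mem hy).resolve_right (hmin P hP)
    rw [mul_comm]
    exact Submodule.smul_mem_smul (Ideal.mem_span_singleton_self x) ha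
  have hbot : P = ⊥ := by
    apply Submodule.eq_bot_of_le_smul_of_le_jacobson_bot (Ideal.span {x}) P
      (IsNoetherian.noetherian P) hle
    rw [IsLocalRing.jacobson_eq_maximalIdeal _ bot_ne_top]
    exact IsLocalRing.le_maximalIdeal hx.ne_top
  rw [hbot] at hPp
  exact IsDomain.of_bot_isPrime R

/-- Induction on the number of generators. Once the first generator is changed to an x outside all
minimal primes, R/(x) satisfies the same hypotheses with one generator fewer, so it is a domain.
Then (x) is prime, R is a domain, x ≠ 0 is regular, and the sequence for R/(x) lifts with x in
front. -/
theorem IsLocalRing.isDomain_and_exists_isRegular_of_le_ringKrullDim {R : Type*} [CommRing R]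
    [IsLocalRing R] [IsNoetherianRing R] (fs : List R) (hfs : Ideal.ofList fs = maximalIdeal R)
    (hdim : (fs.length : WithBot ℕ∞) ≤ ringKrullDim R) :
    IsDomain R ∧ ∃ rs : List R, IsRegular R rs ∧ Ideal.ofList rs = maximalIdeal R := by
  induction hn : fs.length generalizing R with
  | zero =>
    rw [List.length_eq_zero_iff] at hn
    subst hn
    rw [Ideal.ofList_nil] at hfs
    have hp : (⊥ : Ideal R).IsPrime := hfs ▸ inferInstance
    exact ⟨IsDomain.of_bot_isPrime R, [], IsRegular.nil R R, by rw [Ideal.ofList_nil, hfs]⟩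
  | succ n ih =>
    match fs, hn with
    | f :: fs, hn =>
    rw [List.length_cons] at hn hdim
    rw [Ideal.ofList_cons] at hfs
    have hfin := minimalPrimes.finite_of_isNoetherianRing R
    -- A minimal prime containing all generators would be the maximal ideal, of height 0, against
    -- dim R ≥ 1.
    obtain ⟨g, hg, hgP⟩ := Ideal.exists_add_notMem_of_forall_not_sup_le hfin.toFinset
      (fun P hP ↦ ((Set.Finite.mem_toFinset _).mp hP).1.1) f (Ideal.ofList fs) (by
        intro P hP hle
        have hP' := (Set.Finite.mem_toFinset _).mp hP
        have hPp : P.IsPrime := hP'.1.1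
        rw [hfs] at hle
        have hPm : P = maximalIdeal R := le_antisymm (le_maximalIdeal hPp.ne_top) hle
        have h0 : (maximalIdeal R).height = 0 := by
          rw [Ideal.height_eq_zero_iff, ← hPm]
          exact hP'
        rw [← maximalIdeal_height_eq_ringKrullDim, h0] at hdim
        norm_cast at hdim)
    have hxmin : ∀ P ∈ minimalPrimes R, f + g ∉ P := fun P hP ↦
      hgP P ((Set.Finite.mem_toFinset _).mpr hP)
    generalize hx : f + g = x at hxmin
    have hfs' : Ideal.span {x} ⊔ Ideal.ofList fs = maximalIdeal R := by
      rw [← hfs]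
      apply le_antisymm
      · refine sup_le ?_ le_sup_right
        rw [Ideal.span_singleton_le_iff_mem, ← hx]
        exact Ideal.add_mem _ (Ideal.mem_sup_left (Ideal.mem_span_singleton_self f))
          (Ideal.mem_sup_right hg)
      · refine sup_le ?_ le_sup_right
        rw [Ideal.span_singleton_le_iff_mem, ← add_sub_cancel_right f g, hx]
        exact Ideal.sub_mem _ (Ideal.mem_sup_left (Ideal.mem_span_singleton_self x))
          (Ideal.mem_sup_right hg)
    have hxm : x ∈ maximalIdeal R :=
      hfs' ▸ Ideal.mem_sup_left (Ideal.mem_span_singleton_self x)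
    have hne : Ideal.span {x} ≠ ⊤ := by
      rwa [Ne, Ideal.span_singleton_eq_top]
    have : Nontrivial (R ⧸ Ideal.span {x}) := Ideal.Quotient.nontrivial_iff.mpr hne
    have hloc : IsLocalRing (R ⧸ Ideal.span {x}) :=
      IsLocalRing.of_surjective' _ Ideal.Quotient.mk_surjective
    have hmax : maximalIdeal (R ⧸ Ideal.span {x}) =
        (maximalIdeal R).map (Ideal.Quotient.mk (Ideal.span {x})) :=
      (map_maximalIdeal_of_surjective _ Ideal.Quotient.mk_surjective).symm
    have hgen : Ideal.ofList (fs.map (Ideal.Quotient.mk (Ideal.span {x}))) =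
        maximalIdeal (R ⧸ Ideal.span {x}) := by
      rw [hmax, ← hfs', Ideal.map_sup, Ideal.map_quotient_self, bot_sup_eq, Ideal.map_ofList]
    have hdim' : (fs.length : WithBot ℕ∞) ≤ ringKrullDim (R ⧸ Ideal.span {x}) := by
      have h1 := ringKrullDim_le_ringKrullDim_quotient_add_card {x}
        (by simpa [ringJacobson_eq_maximalIdeal] using hxm)
      rw [Finset.coe_singleton, Finset.card_singleton] at h1
      have h2 := hdim.trans h1
      push_cast at h2
      exact (ENat.WithBot.add_le_add_one_right_iff).mp h2
    obtain ⟨hdom, rs, hrs, hrsm⟩ := ih (R := R ⧸ Ideal.span {x}) _ hgen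
      (by simpa using hdim') (by simpa using hn)
    have hdomR : IsDomain R := isDomain_of_isPrime_span_singleton x
      ((Ideal.Quotient.isDomain_iff_prime _).mp hdom) hxmin
    obtain ⟨ts, rfl⟩ := List.map_surjective_iff.mpr
      (Ideal.Quotient.mk_surjective (I := Ideal.span {x})) rs
    have hspan : Ideal.ofList (x :: ts) = maximalIdeal R := by
      rw [← Ideal.map_ofList, hmax,
        Ideal.map_eq_iff_sup_ker_eq_of_surjective _ Ideal.Quotient.mk_surjective,
        Ideal.mk_ker] at hrsm
      rw [Ideal.ofList_cons, sup_comm, hrsm, sup_eq_left, Ideal.span_singleton_le_iff_mem]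
      exact hxm
    refine ⟨hdomR, x :: ts, IsRegular.of_isWeaklyRegular_of_mem_maximalIdeal R
      (fun r hr ↦ hspan ▸ Ideal.subset_span hr) ?_, hspan⟩
    rw [isWeaklyRegular_cons_iff]
    have hx0 : x ≠ 0 := by
      rintro rfl
      exact hxmin ⊥ (by simp [IsDomain.minimalPrimes_eq_singleton_bot]) (Ideal.zero_mem _)
    refine ⟨(isSMulRegular_iff_right_eq_zero_of_smul).mpr
      fun a ha ↦ (mul_eq_zero.mp ha).resolve_left hx0, ?_⟩
    rw [LinearEquiv.isWeaklyRegular_congr (Submodule.quotEquivOfEq (x • (⊤ : Submodule R R))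
      (Ideal.span {x}) (by
        rw [← Submodule.ideal_span_singleton_smul, smul_eq_mul, Ideal.mul_top])) ts]
    exact (isWeaklyRegular_map_algebraMap_iff (R ⧸ Ideal.span {x}) _ ts).mp hrs.1

theorem IsRegularLocalRing.exists_isRegular_ofList_eq_maximalIdeal (R : Type*) [CommRing R]
    [IsRegularLocalRing R] :
    ∃ rs : List R, IsRegular R rs ∧ Ideal.ofList rs = maximalIdeal R := by
  have hfg := (maximalIdeal R).fg_of_isNoetherianRing
  have hfin := Submodule.FG.finite_generators hfg
  refine (isDomain_and_exists_isRegular_of_le_ringKrullDim hfin.toFinset.toList ?_ ?_).2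
  · rw [Ideal.ofList]
    simpa using! (maximalIdeal R).span_generators
  · rw [Finset.length_toList, ← IsRegularLocalRing.spanFinrank_maximalIdeal,
      ← Submodule.FG.generators_ncard hfg, Set.ncard_eq_toFinset_card _ hfin]

/-! ### Projective dimension of cyclic modules and the colon sequence -/

/-- `(R ⧸ I) ⧸ K (R ⧸ I)` is `R ⧸ (I + K)`. -/
noncomputable def Ideal.quotientSMulTopEquivQuotientSup {R : Type*} [CommRing R] (I K : Ideal R) :
    ((R ⧸ I) ⧸ K • (⊤ : Submodule R (R ⧸ I))) ≃ₗ[R] R ⧸ (I ⊔ K) :=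
  (Submodule.quotEquivOfEq _ (Submodule.map (Submodule.mkQ I) K) (by
    conv_rhs => rw [← Ideal.mul_top K, ← smul_eq_mul, Submodule.map_smul'', Submodule.map_top,
      Submodule.range_mkQ])).trans
    (Submodule.quotientQuotientEquivQuotientSup I K)

/-- The short complex `R ⧸ (K : a) → R ⧸ K → R ⧸ (K + (a))`, whose first map is multiplication
by `a`. -/
noncomputable def Ideal.colonShortComplex {R : Type u} [CommRing R] (K : Ideal R) (a : R) :
    ShortComplex (ModuleCat.{u} R) :=
  ModuleCat.shortComplexOfCompEqZero
    (M := R ⧸ K.colon {a}) (N := R ⧸ K) (L := R ⧸ (K ⊔ Ideal.span {a}))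
    (Submodule.mapQ (K.colon {a}) K (LinearMap.lsmul R R a) (by
      intro r hr
      rw [Submodule.mem_colon_singleton] at hr
      simpa [mul_comm] using hr))
    (Submodule.factor le_sup_left) (by
      ext
      simp only [LinearMap.comp_apply, Submodule.mkQ_apply, Submodule.mapQ_apply,
        LinearMap.zero_apply, LinearMap.lsmul_apply]
      rw [Submodule.Quotient.mk_eq_zero]
      exact Ideal.mem_sup_right (by simp [Ideal.mem_span_singleton_self a]))

theorem Ideal.colonShortComplex_shortExact {R : Type u} [CommRing R] (K : Ideal R) (a : R) :
    (K.colonShortComplex a).ShortExact := by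
  apply ModuleCat.shortComplex_shortExact
  · intro y
    constructor
    · intro hy
      obtain ⟨y, rfl⟩ := Submodule.Quotient.mk_surjective _ y
      have hy' : y ∈ K ⊔ Ideal.span {a} := (Submodule.Quotient.mk_eq_zero _).mp hy
      obtain ⟨k, hk, b, hb, rfl⟩ := Submodule.mem_sup.mp hy'
      obtain ⟨c, rfl⟩ := Ideal.mem_span_singleton'.mp hb
      refine ⟨Submodule.Quotient.mk c, ?_⟩
      refine (Submodule.Quotient.eq _).mpr ?_
      simpa [mul_comm] using hk
    · rintro ⟨x, rfl⟩
      exact ConcreteCategory.congr_hom (K.colonShortComplex a).zero x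
  · refine (injective_iff_map_eq_zero _).mpr fun x hx ↦ ?_
    obtain ⟨x, rfl⟩ := Submodule.Quotient.mk_surjective _ x
    have hx' : a • x ∈ K := (Submodule.Quotient.mk_eq_zero _).mp hx
    refine (Submodule.Quotient.mk_eq_zero _).mpr ?_
    rw [Submodule.mem_colon_singleton]
    simpa [mul_comm] using hx'
  · exact Submodule.factor_surjective le_sup_left

theorem projectiveDimension_quotient_sup_ofList {R : Type u} [CommRing R] [IsLocalRing R]
    [IsNoetherianRing R] (I : Ideal R) (hI : I ≠ ⊤) (rs : List R)
    (hrs : IsWeaklyRegular (R ⧸ I) rs) (hm : ∀ r ∈ rs, r ∈ maximalIdeal R) :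
    projectiveDimension (ModuleCat.of R (R ⧸ (I ⊔ Ideal.ofList rs))) =
      projectiveDimension (ModuleCat.of R (R ⧸ I)) + rs.length := by
  have : Nontrivial (R ⧸ I) := Ideal.Quotient.nontrivial_iff.mpr hI
  rw [← ModuleCat.projectiveDimension_quotient_eq_add_length_of_isWeaklyRegular
    (ModuleCat.of R (R ⧸ I)) rs hrs hm]
  exact (projectiveDimension_eq_of_iso
    (Ideal.quotientSMulTopEquivQuotientSup I (Ideal.ofList rs)).toModuleIso).symm

theorem projectiveDimension_quotient_ofList {R : Type u} [CommRing R] [IsLocalRing R]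
    [IsNoetherianRing R] (rs : List R) (hrs : IsRegular R rs) :
    projectiveDimension (ModuleCat.of R (R ⧸ Ideal.ofList rs)) = rs.length := by
  rw [← ModuleCat.projectiveDimension_quotient_eq_length.{u} rs hrs]
  exact projectiveDimension_eq_of_iso (Shrink.linearEquiv R (R ⧸ Ideal.ofList rs)).symm.toModuleIso

/-! ### Hilbert's syzygy theorem and Auslander–Buchsbaum for cyclic modules -/

theorem Ideal.exists_colon_singleton_eq_of_isAssociatedPrime {R : Type*} [CommRing R]
    [IsNoetherianRing R] {I P : Ideal R} (h : IsAssociatedPrime P (R ⧸ I)) :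
    ∃ a ∉ I, I.colon {a} = P := by
  obtain ⟨hP, x, hx⟩ := isAssociatedPrime_iff.mp h
  obtain ⟨a, rfl⟩ := Submodule.Quotient.mk_surjective _ x
  have key : I.colon {a} = P := by
    ext r
    rw [hx, Submodule.mem_colon_singleton, Submodule.mem_colon_singleton,
      ← Submodule.Quotient.mk_smul, Submodule.mem_bot, Submodule.Quotient.mk_eq_zero]
  refine ⟨a, fun ha ↦ hP.ne_top ?_, key⟩
  rw [← key, Submodule.colon_eq_top_iff_subset]
  simpa using ha

/-- Hilbert's syzygy theorem for cyclic modules, with the dimension of the regular local ring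
given as the length of a regular sequence that generates the maximal ideal. -/
theorem hasProjectiveDimensionLE_quotient_of_isRegular_ofList_eq_maximalIdeal {R : Type u}
    [CommRing R] [IsLocalRing R] [IsNoetherianRing R] (ts : List R) (hts : IsRegular R ts)
    (hm : Ideal.ofList ts = maximalIdeal R) (I : Ideal R) :
    HasProjectiveDimensionLE (ModuleCat.of R (R ⧸ I)) ts.length := by
  induction I using WellFoundedGT.induction with
  | ind I ih =>
  by_cases hI : I = ⊤
  · subst hI
    have : Limits.IsZero (ModuleCat.of R (R ⧸ (⊤ : Ideal R))) :=
      ModuleCat.isZero_of_subsingleton _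
    have := this.hasProjectiveDimensionLT_zero
    exact hasProjectiveDimensionLT_of_ge _ 0 _ (Nat.zero_le _)
  have hnt : Nontrivial (R ⧸ I) := Ideal.Quotient.nontrivial_iff.mpr hI
  obtain ⟨P, hP⟩ := associatedPrimes.nonempty R (R ⧸ I)
  obtain ⟨a, haI, haP⟩ := Ideal.exists_colon_singleton_eq_of_isAssociatedPrime hP
  have hle : I ≤ P := by rw [← haP]; exact Ideal.le_colon
  -- If I = P is maximal, the regular sequence `ts` computes the projective dimension. If I = P is
  -- another prime, adding x ∉ P raises it by one and enlarges the ideal. If I < P, the colon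
  -- sequence squeezes R/I between R/P and R/(I + (a)).
  rcases hle.eq_or_lt with rfl | hlt
  · have hIp : I.IsPrime := hP.isPrime
    by_cases hmax : I = maximalIdeal R
    · rw [hmax, ← hm, ← projectiveDimension_le_iff, projectiveDimension_quotient_ofList ts hts]
    · obtain ⟨x, hxm, hxI⟩ := SetLike.exists_of_lt
        (lt_of_le_of_ne (le_maximalIdeal hI) hmax)
      have hreg : IsWeaklyRegular (R ⧸ I) [x] := by
        rw [isWeaklyRegular_singleton_iff, isSMulRegular_iff_right_eq_zero_of_smul]
        intro r hr
        obtain ⟨r, rfl⟩ := Submodule.Quotient.mk_surjective _ r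
        rw [← Submodule.Quotient.mk_smul, Submodule.Quotient.mk_eq_zero] at hr
        rw [Submodule.Quotient.mk_eq_zero]
        exact (hIp.mem_or_mem hr).resolve_left hxI
      have h1 := projectiveDimension_quotient_sup_ofList I hI [x] hreg (by simpa using hxm)
      have h2 := ih (I ⊔ Ideal.ofList [x]) (left_lt_sup.mpr (by simpa using hxI))
      rw [← projectiveDimension_le_iff] at h2 ⊢
      rw [h1] at h2
      refine le_trans ?_ h2
      exact le_add_of_nonneg_right (Nat.cast_nonneg _)
  · have h1 := ih P hlt
    have h3 := ih (I ⊔ Ideal.span {a}) (left_lt_sup.mpr (by simpa using haI))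
    rw [← haP] at h1
    exact (I.colonShortComplex_shortExact a).hasProjectiveDimensionLT_X₂ _ h1 h3

theorem exists_isSMulRegular_of_forall_associatedPrimes_not_le {R : Type*} [CommRing R]
    [IsNoetherianRing R] (M : Type*) [AddCommGroup M] [Module R M] [Module.Finite R M]
    (J : Ideal R) (h : ∀ P ∈ associatedPrimes R M, ¬ J ≤ P) :
    ∃ x ∈ J, IsSMulRegular M x := by
  have hfin := associatedPrimes.finite R M
  obtain ⟨y, hy, hyP⟩ := Ideal.exists_add_notMem_of_forall_not_sup_le hfin.toFinset
    (fun P hP ↦ ((Set.Finite.mem_toFinset _).mp hP).isPrime) 0 J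
    (fun P hP hle ↦ h P ((Set.Finite.mem_toFinset _).mp hP) (le_sup_right.trans hle))
  refine ⟨y, hy, ?_⟩
  by_contra hreg
  have hmem : y ∈ ⋃ p ∈ associatedPrimes R M, (p : Set R) := by
    rw [biUnion_associatedPrimes_eq_compl_regular]
    exact hreg
  simp only [Set.mem_iUnion, SetLike.mem_coe] at hmem
  obtain ⟨P, hP, hyP'⟩ := hmem
  exact hyP P ((Set.Finite.mem_toFinset _).mpr hP) (by rwa [zero_add])

/-- A cyclic module over a regular local ring has a regular sequence in the maximal ideal whose
length is complementary to the projective dimension. -/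
theorem exists_isWeaklyRegular_projectiveDimension_add_length_eq {R : Type u}
    [CommRing R] [IsLocalRing R] [IsNoetherianRing R] (ts : List R) (hts : IsRegular R ts)
    (hm : Ideal.ofList ts = maximalIdeal R) (I : Ideal R) (hI : I ≠ ⊤) :
    ∃ rs : List R, (∀ r ∈ rs, r ∈ maximalIdeal R) ∧ IsWeaklyRegular (R ⧸ I) rs ∧
      projectiveDimension (ModuleCat.of R (R ⧸ I)) + rs.length = ts.length := by
  induction I using WellFoundedGT.induction with
  | ind I ih =>
  have hnt : Nontrivial (R ⧸ I) := Ideal.Quotient.nontrivial_iff.mpr hI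
  by_cases hass : maximalIdeal R ∈ associatedPrimes R (R ⧸ I)
  · refine ⟨[], by simp, IsWeaklyRegular.nil _ _, ?_⟩
    obtain ⟨a, haI, ha⟩ := Ideal.exists_colon_singleton_eq_of_isAssociatedPrime hass
    simp only [List.length_nil, Nat.cast_zero, add_zero]
    apply le_antisymm
    · rw [projectiveDimension_le_iff]
      exact hasProjectiveDimensionLE_quotient_of_isRegular_ofList_eq_maximalIdeal ts hts hm I
    -- The residue field embeds in R/I with cyclic cokernel. Were pd R/I < d, the syzygy bound on
    -- the cokernel would give the residue field projective dimension below d.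
    · rw [projectiveDimension_ge_iff]
      intro h2
      have h1 : HasProjectiveDimensionLT (ModuleCat.of R (R ⧸ I.colon {a})) ts.length :=
        (I.colonShortComplex_shortExact a).hasProjectiveDimensionLT_X₁ _ h2
          (hasProjectiveDimensionLE_quotient_of_isRegular_ofList_eq_maximalIdeal ts hts hm _)
      rw [ha, ← hm, ← projectiveDimension_lt_iff, projectiveDimension_quotient_ofList ts hts] at h1
      exact lt_irrefl _ h1
  · obtain ⟨x, hxm, hx⟩ := exists_isSMulRegular_of_forall_associatedPrimes_not_le (R ⧸ I)
      (maximalIdeal R) (fun P hP hle ↦ hass (by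
        rwa [le_antisymm hle (le_maximalIdeal (IsAssociatedPrime.isPrime hP).ne_top)]))
    have hxI : x ∉ I := by
      intro hxI
      obtain ⟨r, hr⟩ := exists_ne (0 : R ⧸ I)
      refine hr ((isSMulRegular_iff_right_eq_zero_of_smul.mp hx) r ?_)
      obtain ⟨r, rfl⟩ := Submodule.Quotient.mk_surjective _ r
      rw [← Submodule.Quotient.mk_smul, Submodule.Quotient.mk_eq_zero]
      exact I.mul_mem_right r hxI
    have hne : I ⊔ Ideal.ofList [x] ≠ ⊤ := by
      refine ne_top_of_le_ne_top (maximalIdeal.isMaximal R).ne_top (sup_le (le_maximalIdeal hI) ?_)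
      simpa using hxm
    obtain ⟨rs, hrsm, hrs, hpd⟩ := ih (I ⊔ Ideal.ofList [x])
      (left_lt_sup.mpr (by simpa using hxI)) hne
    refine ⟨x :: rs, by simpa using ⟨hxm, hrsm⟩, ?_, ?_⟩
    · have := (isWeaklyRegular_append_iff (R ⧸ I) [x] rs).mpr
        ⟨(isWeaklyRegular_singleton_iff _ _).mpr hx,
          (LinearEquiv.isWeaklyRegular_congr
            (Ideal.quotientSMulTopEquivQuotientSup I (Ideal.ofList [x])) rs).mpr hrs⟩
      simpa using this
    · rw [projectiveDimension_quotient_sup_ofList I hI [x]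
        ((isWeaklyRegular_singleton_iff _ _).mpr hx) (by simpa using hxm)] at hpd
      rw [← hpd, List.length_cons, List.length_singleton, add_assoc, Nat.cast_add, add_comm
        (rs.length : WithBot ℕ∞)]

/-- The sequence from the previous theorem is as long as possible: killing a regular sequence raises
the projective dimension by its length, and the syzygy theorem caps the result at `ts.length`. -/
theorem exists_projectiveDimension_eq_and_localDepth_eq {R : Type u}
    [CommRing R] [IsLocalRing R] [IsNoetherianRing R] (ts : List R) (hts : IsRegular R ts)
    (hm : Ideal.ofList ts = maximalIdeal R) (I : Ideal R) (hI : I ≠ ⊤) :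
    ∃ (rs : List R) (p : ℕ), (∀ r ∈ rs, r ∈ maximalIdeal R) ∧ IsWeaklyRegular (R ⧸ I) rs ∧
      projectiveDimension (ModuleCat.of R (R ⧸ I)) = p ∧ p + rs.length = ts.length ∧
      localDepth R (R ⧸ I) = rs.length := by
  have hnt : Nontrivial (R ⧸ I) := Ideal.Quotient.nontrivial_iff.mpr hI
  obtain ⟨rs, hrsm, hrs, hpd⟩ :=
    exists_isWeaklyRegular_projectiveDimension_add_length_eq ts hts hm I hI
  have hle (ss : List R) (hss : IsWeaklyRegular (R ⧸ I) ss) (hssm : ∀ s ∈ ss, s ∈ maximalIdeal R) :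
      projectiveDimension (ModuleCat.of R (R ⧸ I)) + ss.length ≤ ts.length := by
    rw [← projectiveDimension_quotient_sup_ofList I hI ss hss hssm, projectiveDimension_le_iff]
    exact hasProjectiveDimensionLE_quotient_of_isRegular_ofList_eq_maximalIdeal ts hts hm _
  obtain ⟨p, hp⟩ : ∃ p : ℕ, projectiveDimension (ModuleCat.of R (R ⧸ I)) = p := by
    generalize projectiveDimension (ModuleCat.of R (R ⧸ I)) = q at hpd
    match q with
    | ⊥ => simp at hpd
    | (⊤ : ℕ∞) => norm_cast at hpd
    | ((q : ℕ) : ℕ∞) => exact ⟨q, rfl⟩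
  rw [hp] at hpd hle
  norm_cast at hpd
  refine ⟨rs, p, hrsm, hrs, hp, hpd, le_antisymm ?_ ?_⟩
  · refine iSup₂_le fun ss hss ↦ ?_
    have := hle ss hss.1.toIsWeaklyRegular hss.2
    norm_cast at this ⊢
    omega
  · exact le_iSup₂_of_le rs ⟨IsRegular.of_isWeaklyRegular_of_mem_maximalIdeal _ hrsm hrs, hrsm⟩
      le_rfl

/-! ### Depth and the dimension of associated primes -/

/-- The length of a regular sequence on `M` is at most the dimension of any associated prime. -/
theorem RingTheory.Sequence.IsWeaklyRegular.length_le_ringKrullDim_quotient_of_mem_associatedPrimes {R : Type*}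
    [CommRing R] [IsLocalRing R] [IsNoetherianRing R] (rs : List R)
    (hm : ∀ r ∈ rs, r ∈ maximalIdeal R) (M : Type*) [AddCommGroup M] [Module R M]
    [Module.Finite R M] (hrs : IsWeaklyRegular M rs) (P : Ideal R)
    (hP : P ∈ associatedPrimes R M) : (rs.length : WithBot ℕ∞) ≤ ringKrullDim (R ⧸ P) := by
  induction rs generalizing M P with
  | nil =>
    have := Ideal.Quotient.nontrivial_iff.mpr (IsAssociatedPrime.isPrime hP).ne_top
    simpa using ringKrullDim_nonneg_of_nontrivial
  | cons x rs ih =>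
    rw [isWeaklyRegular_cons_iff] at hrs
    obtain ⟨hx, hrs⟩ := hrs
    rw [List.forall_mem_cons] at hm
    have hPp : P.IsPrime := IsAssociatedPrime.isPrime hP
    obtain ⟨-, m, hPm⟩ := isAssociatedPrime_iff.mp hP
    have hx' := isSMulRegular_iff_right_eq_zero_of_smul.mp hx
    have hm0 : m ≠ 0 := by
      rintro rfl
      exact hPp.ne_top (by rw [hPm, Submodule.colon_singleton_zero])
    have hmP (r : R) : r ∈ P ↔ r • m = 0 := by
      rw [hPm, Submodule.mem_colon_singleton, Submodule.mem_bot]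
    have hxP : x ∉ P := fun h ↦ hm0 (hx' m ((hmP x).mp h))
    -- Otherwise the submodule T killed by P lies in xM; as x is regular, T = xT, so T = 0 by
    -- Nakayama, although m ≠ 0 lies in T.
    obtain ⟨n, hnP, hn⟩ : ∃ n : M, (∀ r ∈ P, r • n = 0) ∧ n ∉ x • (⊤ : Submodule R M) := by
      by_contra! hcon
      have hN : Submodule.torsionBySet R M P = ⊥ := by
        apply Submodule.eq_bot_of_le_smul_of_le_jacobson_bot (Ideal.span {x}) _
          (IsNoetherian.noetherian _)
        · intro n hn
          have hn' : ∀ r ∈ P, r • n = 0 := by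
            simpa [Submodule.mem_torsionBySet_iff] using hn
          obtain ⟨k, -, rfl⟩ := (Submodule.mem_smul_pointwise_iff_exists _ _ _).mp (hcon n hn')
          refine Submodule.smul_mem_smul (Ideal.mem_span_singleton_self x) ?_
          rw [Submodule.mem_torsionBySet_iff]
          rintro ⟨r, hr⟩
          refine hx' _ ?_
          change x • r • k = 0
          rw [smul_comm]
          exact hn' r hr
        · rw [IsLocalRing.jacobson_eq_maximalIdeal _ bot_ne_top,
            Ideal.span_singleton_le_iff_mem]
          exact hm.1
      refine hm0 ((Submodule.mem_bot R).mp (hN ▸ ?_))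
      rw [Submodule.mem_torsionBySet_iff]
      rintro ⟨r, hr⟩
      exact (hmP r).mp hr
    obtain ⟨Q, hQ, hnQ⟩ := exists_le_isAssociatedPrime_of_isNoetherianRing R
      (Submodule.Quotient.mk n : QuotSMulTop x M)
      (fun h ↦ hn ((Submodule.Quotient.mk_eq_zero _).mp h))
    have hPQ : P ≤ Q := fun r hr ↦ hnQ (by
      rw [Submodule.mem_colon_singleton, ← Submodule.Quotient.mk_smul, hnP r hr,
        Submodule.Quotient.mk_zero]
      exact Submodule.zero_mem _)
    have hxQ : x ∈ Q := hnQ (by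
      rw [Submodule.mem_colon_singleton, ← Submodule.Quotient.mk_smul, Submodule.mem_bot,
        Submodule.Quotient.mk_eq_zero]
      exact Submodule.smul_mem_pointwise_smul n x _ trivial)
    have hdim : ringKrullDim (R ⧸ Q) + 1 ≤ ringKrullDim (R ⧸ P) := by
      refine ringKrullDim_succ_le_of_surjective (Ideal.Quotient.factor hPQ)
        (Ideal.Quotient.factor_surjective hPQ) (r := Ideal.Quotient.mk P x) ?_ ?_
      · rw [mem_nonZeroDivisors_iff_ne_zero, Ne, Ideal.Quotient.eq_zero_iff_mem]
        exact hxP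
      · rw [Ideal.Quotient.factor_mk, Ideal.Quotient.eq_zero_iff_mem]
        exact hxQ
    refine le_trans ?_ hdim
    rw [List.length_cons, Nat.cast_add, Nat.cast_one]
    exact add_le_add_left (ih hm.2 (QuotSMulTop x M) hrs Q hQ) 1

/-! ### Exchanging one element of the regular sequence -/

section Exchange

variable {R : Type u} [CommRing R] {K J : Ideal R} {a b : R}

/-- If rJ ⊆ (K,a), then rb ≡ as mod K for some s. For j ∈ J write rj ≡ at; then a(sj - bt) ∈ K, and
cancelling a gives sJ ⊆ (K,b). Hence br ≡ as with s in (K,b):J. -/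
theorem Ideal.map_lsmul_ker_factor_colon_le (ha : IsSMulRegular (R ⧸ K) a) (hbJ : b ∈ J)
    (h₁ : K ≤ (K ⊔ Ideal.span {a}).colon (J : Set R))
    (h₂ : K ≤ (K ⊔ Ideal.span {b}).colon (J : Set R)) :
    (LinearMap.ker (Submodule.factor h₁)).map (LinearMap.lsmul R (R ⧸ K) b) ≤
      (LinearMap.ker (Submodule.factor h₂)).map (LinearMap.lsmul R (R ⧸ K) a) := by
  have key (r x : R) : r ∈ K ⊔ Ideal.span {x} ↔ ∃ s, r - x * s ∈ K := by
    rw [Submodule.mem_sup]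
    constructor
    · rintro ⟨k, hk, y, hy, rfl⟩
      obtain ⟨s, rfl⟩ := Ideal.mem_span_singleton.mp hy
      exact ⟨s, by simpa using hk⟩
    · rintro ⟨s, hs⟩
      exact ⟨_, hs, x * s, Ideal.mem_span_singleton.mpr ⟨s, rfl⟩, by ring⟩
  have hreg (r : R) (hr : a * r ∈ K) : r ∈ K := by
    rw [← Submodule.Quotient.mk_eq_zero] at hr ⊢
    exact isSMulRegular_iff_right_eq_zero_of_smul.mp ha _ hr
  rintro _ ⟨r, hr, rfl⟩
  obtain ⟨r, rfl⟩ := Submodule.Quotient.mk_surjective _ r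
  have hrJ : ∀ j ∈ J, r * j ∈ K ⊔ Ideal.span {a} :=
    Submodule.mem_colon.mp ((Submodule.Quotient.mk_eq_zero _).mp hr)
  obtain ⟨s, hs⟩ := (key _ _).mp (hrJ b hbJ)
  refine ⟨Submodule.Quotient.mk s, ?_, ?_⟩
  · refine (Submodule.Quotient.mk_eq_zero _).mpr (Submodule.mem_colon.mpr fun j hj ↦ ?_)
    obtain ⟨t, ht⟩ := (key _ _).mp (hrJ j hj)
    refine (key _ _).mpr ⟨t, hreg _ ?_⟩
    change a * (s * j - b * t) ∈ K
    have : a * (s * j - b * t) = b * (r * j - a * t) - j * (r * b - a * s) := by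
      ring
    rw [this]
    exact K.sub_mem (K.mul_mem_left _ ht) (K.mul_mem_left _ hs)
  · refine (Submodule.Quotient.eq _).mpr ?_
    have : a • s - b • r = -(r * b - a * s) := by simp only [smul_eq_mul]; ring
    rw [this]
    exact K.neg_mem hs

/-- Multiplications by b and by a are injective on R/K and, by the inclusion above used both ways,
carry the two kernels onto the same submodule. -/
theorem Ideal.nonempty_ker_factor_colon_linearEquiv (ha : IsSMulRegular (R ⧸ K) a)
    (hb : IsSMulRegular (R ⧸ K) b) (haJ : a ∈ J) (hbJ : b ∈ J)
    (h₁ : K ≤ (K ⊔ Ideal.span {a}).colon (J : Set R))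
    (h₂ : K ≤ (K ⊔ Ideal.span {b}).colon (J : Set R)) :
    Nonempty (LinearMap.ker (Submodule.factor h₁) ≃ₗ[R] LinearMap.ker (Submodule.factor h₂)) :=
  ⟨(Submodule.equivMapOfInjective (LinearMap.lsmul R (R ⧸ K) b) hb _).trans
    ((LinearEquiv.ofEq _ _ (le_antisymm
      (Ideal.map_lsmul_ker_factor_colon_le ha hbJ h₁ h₂)
      (Ideal.map_lsmul_ker_factor_colon_le hb haJ h₂ h₁))).trans
    (Submodule.equivMapOfInjective (LinearMap.lsmul R (R ⧸ K) a) ha _).symm)⟩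

theorem hasProjectiveDimensionLT_quotient_colon_of_exchange (ha : IsSMulRegular (R ⧸ K) a)
    (hb : IsSMulRegular (R ⧸ K) b) (haJ : a ∈ J) (hbJ : b ∈ J) (n : ℕ)
    (hK : HasProjectiveDimensionLT (ModuleCat.of R (R ⧸ K)) n)
    (h : HasProjectiveDimensionLT
      (ModuleCat.of R (R ⧸ (K ⊔ Ideal.span {a}).colon (J : Set R))) (n + 1)) :
    HasProjectiveDimensionLT
      (ModuleCat.of R (R ⧸ (K ⊔ Ideal.span {b}).colon (J : Set R))) (n + 1) := by
  have h₁ : K ≤ (K ⊔ Ideal.span {a}).colon (J : Set R) := le_sup_left.trans Ideal.le_colon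
  have h₂ : K ≤ (K ⊔ Ideal.span {b}).colon (J : Set R) := le_sup_left.trans Ideal.le_colon
  obtain ⟨e⟩ := Ideal.nonempty_ker_factor_colon_linearEquiv ha hb haJ hbJ h₁ h₂
  have hX := (LinearMap.shortExact_shortComplexKer
    (Submodule.factor_surjective h₁)).hasProjectiveDimensionLT_X₁ n hK h
  exact (LinearMap.shortExact_shortComplexKer
    (Submodule.factor_surjective h₂)).hasProjectiveDimensionLT_X₃ n
      (hasProjectiveDimensionLT_of_iso e.toModuleIso n)
      (hasProjectiveDimensionLT_of_ge _ n _ (Nat.le_succ n))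

end Exchange

/-! ### Reduction to an ideal generated by a regular sequence and one element -/

theorem RingTheory.Sequence.IsRegular.mem_maximalIdeal {R : Type*} [CommRing R] [IsLocalRing R]
    {rs : List R} (h : IsRegular R rs) : ∀ r ∈ rs, r ∈ maximalIdeal R := by
  intro r hr
  refine le_maximalIdeal ?_ (Ideal.subset_span hr : r ∈ Ideal.ofList rs)
  simpa using h.top_ne_smul.symm

theorem isRegular_append_singleton_iff {R : Type*} [CommRing R] [IsLocalRing R]
    [IsNoetherianRing R] {ys : List R} {a : R} (ha : a ∈ maximalIdeal R) :
    IsRegular R (ys ++ [a]) ↔ IsRegular R ys ∧ IsSMulRegular (R ⧸ Ideal.ofList ys) a := by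
  have e := Submodule.quotEquivOfEq (Ideal.ofList ys • (⊤ : Submodule R R)) (Ideal.ofList ys)
    (by rw [smul_eq_mul, Ideal.mul_top])
  have key : IsWeaklyRegular R (ys ++ [a]) ↔
      IsWeaklyRegular R ys ∧ IsSMulRegular (R ⧸ Ideal.ofList ys) a := by
    rw [isWeaklyRegular_append_iff, isWeaklyRegular_singleton_iff, e.isSMulRegular_congr]
  constructor
  · intro h
    refine ⟨IsRegular.of_isWeaklyRegular_of_mem_maximalIdeal _
      (fun r hr ↦ h.mem_maximalIdeal r (List.mem_append_left _ hr))
      (key.mp h.toIsWeaklyRegular).1, (key.mp h.toIsWeaklyRegular).2⟩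
  · rintro ⟨h1, h2⟩
    refine IsRegular.of_isWeaklyRegular_of_mem_maximalIdeal _ ?_
      (key.mpr ⟨h1.toIsWeaklyRegular, h2⟩)
    intro r hr
    rcases List.mem_append.mp hr with hr | hr
    · exact h1.mem_maximalIdeal r hr
    · rwa [List.mem_singleton.mp hr]

theorem Ideal.ofList_eq_of_perm {R : Type*} [CommRing R] {as bs : List R} (h : as.Perm bs) :
    Ideal.ofList as = Ideal.ofList bs :=
  congrArg Ideal.span (Set.ext fun _ ↦ h.mem_iff)

/-- A regular sequence `zs ++ ws` in an ideal `J` generated by `ws` and `zs.length + 1` further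
elements can be exchanged, one element at a time, for a regular sequence that generates `J`
together with one further element, without changing the bounds on the projective dimension of the
quotient by the colon ideal. -/
theorem exists_isRegular_sup_span_singleton_eq {R : Type u} [CommRing R] [IsLocalRing R]
    [IsNoetherianRing R] (J : Ideal R) (hJ : J ≠ ⊤) (zs ws fs : List R)
    (hreg : IsRegular R (zs ++ ws)) (hzJ : ∀ z ∈ zs, z ∈ J)
    (hlen : fs.length = zs.length + 1) (hgen : Ideal.ofList ws ⊔ Ideal.ofList fs = J) :
    ∃ (vs : List R) (f : R), IsRegular R vs ∧ vs.length = (zs ++ ws).length ∧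
      Ideal.ofList vs ⊔ Ideal.span {f} = J ∧ ∀ n, (zs ++ ws).length ≤ n →
        (HasProjectiveDimensionLT (ModuleCat.of R
          (R ⧸ (Ideal.ofList (zs ++ ws)).colon (J : Set R))) (n + 1) ↔
        HasProjectiveDimensionLT (ModuleCat.of R
          (R ⧸ (Ideal.ofList vs).colon (J : Set R))) (n + 1)) := by
  induction hk : zs.length generalizing zs ws fs with
  | zero =>
    rw [List.length_eq_zero_iff] at hk
    subst hk
    obtain ⟨f, rfl⟩ := List.length_eq_one_iff.mp (by simpa using hlen)
    exact ⟨ws, f, hreg, rfl, by simpa using hgen, fun n _ ↦ Iff.rfl⟩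
  | succ k ih =>
    obtain ⟨zs, a, rfl⟩ := List.eq_nil_or_concat'.{u} zs |>.resolve_left (by
      rintro rfl; simp at hk)
    match fs, hlen with
    | f :: fs, hlen =>
    have haJ : a ∈ J := hzJ a (by simp)
    have hperm : (zs ++ [a] ++ ws).Perm (zs ++ ws ++ [a]) := by
      rw [List.append_assoc, List.append_assoc]
      exact List.perm_append_comm.append_left zs
    have hreg' := isRegular_of_perm hreg hperm
    obtain ⟨hreg₀, ha⟩ := (isRegular_append_singleton_iff (le_maximalIdeal hJ haJ)).mp hreg'
    have hwJ : Ideal.ofList ws ≤ J := hgen ▸ le_sup_left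
    have hfsJ : Ideal.ofList fs ≤ J := by
      rw [← hgen, Ideal.ofList_cons]
      exact le_sup_right.trans le_sup_right
    have hfJ : f ∈ J := by
      rw [← hgen, Ideal.ofList_cons]
      exact Ideal.mem_sup_right (Ideal.mem_sup_left (Ideal.mem_span_singleton_self f))
    have hfin := associatedPrimes.finite R (R ⧸ Ideal.ofList (zs ++ ws))
    -- An associated prime of R/(zs, ws) contains `ws`; if it also contained `f` and `fs` it would
    -- contain J, hence `a`, which is regular on this quotient.
    obtain ⟨g, hg, hgP⟩ := Ideal.exists_add_notMem_of_forall_not_sup_le hfin.toFinset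
      (fun P hP ↦ ((Set.Finite.mem_toFinset _).mp hP).isPrime) f (Ideal.ofList fs) (by
        intro P hP hle
        have hP' := (Set.Finite.mem_toFinset _).mp hP
        have hwP : Ideal.ofList ws ≤ P := by
          obtain ⟨c, -, rfl⟩ := Ideal.exists_colon_singleton_eq_of_isAssociatedPrime hP'
          refine le_trans ?_ Ideal.le_colon
          rw [Ideal.ofList_append]
          exact le_sup_right
        have haP : a ∈ P := by
          rw [← Ideal.ofList_cons] at hle
          exact (sup_le hwP hle) (hgen ▸ haJ)
        have hmem : a ∈ ⋃ p ∈ associatedPrimes R (R ⧸ Ideal.ofList (zs ++ ws)), (p : Set R) :=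
          Set.mem_biUnion hP' haP
        rw [biUnion_associatedPrimes_eq_compl_regular] at hmem
        exact hmem ha)
    have hbJ : f + g ∈ J := J.add_mem hfJ (hfsJ hg)
    have hb : IsSMulRegular (R ⧸ Ideal.ofList (zs ++ ws)) (f + g) := by
      by_contra hcon
      have hmem : f + g ∈ ⋃ p ∈ associatedPrimes R (R ⧸ Ideal.ofList (zs ++ ws)), (p : Set R) := by
        rw [biUnion_associatedPrimes_eq_compl_regular]
        exact hcon
      simp only [Set.mem_iUnion, SetLike.mem_coe] at hmem
      obtain ⟨P, hP, hbP⟩ := hmem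
      exact hgP P ((Set.Finite.mem_toFinset _).mpr hP) hbP
    generalize hbdef : f + g = b at hbJ hb
    have hregb := (isRegular_append_singleton_iff (le_maximalIdeal hJ hbJ)).mpr ⟨hreg₀, hb⟩
    have hpermb : (zs ++ ws ++ [b]).Perm (zs ++ b :: ws) := by
      rw [List.append_assoc]
      exact (List.perm_append_singleton b ws).append_left zs
    have hgen' : Ideal.ofList (b :: ws) ⊔ Ideal.ofList fs = J := by
      apply le_antisymm
      · rw [Ideal.ofList_cons]
        refine sup_le (sup_le ?_ hwJ) hfsJ
        rwa [Ideal.span_singleton_le_iff_mem]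
      · rw [← hgen, Ideal.ofList_cons, Ideal.ofList_cons]
        refine sup_le (le_sup_right.trans le_sup_left) (sup_le ?_ le_sup_right)
        rw [Ideal.span_singleton_le_iff_mem, ← add_sub_cancel_right f g, hbdef]
        exact Ideal.sub_mem _
          (Ideal.mem_sup_left (Ideal.mem_sup_left (Ideal.mem_span_singleton_self b)))
          (Ideal.mem_sup_right hg)
    obtain ⟨vs, c, hvs, hvlen, hvJ, hpd⟩ := ih zs (b :: ws) fs (isRegular_of_perm hregb hpermb)
      (fun z hz ↦ hzJ z (List.mem_append_left _ hz)) (by simpa using hlen) hgen' (by simpa using hk)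
    refine ⟨vs, c, hvs, by simpa [add_assoc, add_comm, add_left_comm] using hvlen, hvJ,
      fun n hn ↦ ?_⟩
    rw [← hpd n (by simpa [add_assoc, add_comm, add_left_comm] using hn),
      Ideal.ofList_eq_of_perm hperm, ← Ideal.ofList_eq_of_perm hpermb,
      Ideal.ofList_append (zs ++ ws), Ideal.ofList_append (zs ++ ws), Ideal.ofList_singleton,
      Ideal.ofList_singleton]
    -- K has one generator fewer than the full sequence, so pd R/K is strictly below n.
    have hK : HasProjectiveDimensionLT (ModuleCat.of R (R ⧸ Ideal.ofList (zs ++ ws))) n := by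
      rw [← projectiveDimension_lt_iff, projectiveDimension_quotient_ofList _ hreg₀]
      simp only [List.length_append, List.length_singleton] at hn ⊢
      exact_mod_cast (by omega : zs.length + ws.length < n)
    exact ⟨hasProjectiveDimensionLT_quotient_colon_of_exchange ha hb haJ hbJ n hK,
      hasProjectiveDimensionLT_quotient_colon_of_exchange hb ha hbJ haJ n hK⟩

/-- The projective dimensions of `R ⧸ J` and of `R ⧸ ((z) : J)` determine each other in the range
above the length of `z`. -/
theorem hasProjectiveDimensionLT_quotient_iff_colon {R : Type u} [CommRing R] [IsLocalRing R]
    [IsNoetherianRing R] (J : Ideal R) (hJ : J ≠ ⊤) (zs fs : List R) (hreg : IsRegular R zs)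
    (hzJ : ∀ z ∈ zs, z ∈ J) (hlen : fs.length = zs.length + 1) (hgen : Ideal.ofList fs = J)
    (n : ℕ) (hn : zs.length ≤ n) :
    HasProjectiveDimensionLT (ModuleCat.of R (R ⧸ J)) (n + 2) ↔
      HasProjectiveDimensionLT
        (ModuleCat.of R (R ⧸ (Ideal.ofList zs).colon (J : Set R))) (n + 1) := by
  obtain ⟨vs, f, hvs, hvlen, hvJ, hpd⟩ := exists_isRegular_sup_span_singleton_eq J hJ zs [] fs
    (by simpa using hreg) hzJ hlen (by simpa using hgen)
  rw [List.append_nil] at hpd hvlen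
  rw [hpd n hn]
  have hcolon : (Ideal.ofList vs).colon (J : Set R) = (Ideal.ofList vs).colon {f} := by
    rw [← hvJ]
    apply le_antisymm
    · exact Submodule.colon_mono le_rfl
        (by simpa using! Ideal.mem_sup_right (Ideal.mem_span_singleton_self f))
    · intro r hr
      rw [Submodule.mem_colon_singleton, smul_eq_mul] at hr
      refine Submodule.mem_colon.mpr fun j hj ↦ ?_
      obtain ⟨v, hv, y, hy, rfl⟩ := Submodule.mem_sup.mp hj
      obtain ⟨c, rfl⟩ := Ideal.mem_span_singleton'.mp hy
      rw [smul_eq_mul, mul_add, mul_left_comm]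
      exact add_mem (Ideal.mul_mem_left _ _ hv) (Ideal.mul_mem_left _ _ hr)
  have hV : HasProjectiveDimensionLT (ModuleCat.of R (R ⧸ Ideal.ofList vs)) (n + 1) := by
    change HasProjectiveDimensionLE _ n
    rw [← projectiveDimension_le_iff, projectiveDimension_quotient_ofList _ hvs, hvlen]
    exact_mod_cast hn
  have hS := (Ideal.ofList vs).colonShortComplex_shortExact f
  rw [hcolon]
  constructor
  · intro h
    refine hS.hasProjectiveDimensionLT_X₁ (n + 1) hV ?_
    rw [← hvJ] at h
    exact h
  · intro h
    have := hS.hasProjectiveDimensionLT_X₃ (n + 1) h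
      (hasProjectiveDimensionLT_of_ge (ModuleCat.of R (R ⧸ Ideal.ofList vs)) (n + 1) _
        (Nat.le_succ _))
    rw [← hvJ]
    exact this

/-! ### Dimension counts and conclusion -/

/-- If `I` is a proper ideal that contains a regular sequence `zs` of a Noetherian local ring, then
a regular sequence on `R ⧸ I` has length at most `dim R - zs.length`. -/
theorem length_add_length_le_ringKrullDim {R : Type*} [CommRing R] [IsLocalRing R]
    [IsNoetherianRing R] (I : Ideal R) (hI : I ≠ ⊤) (zs : List R) (hzs : IsRegular R zs)
    (hzI : Ideal.ofList zs ≤ I) (rs : List R) (hm : ∀ r ∈ rs, r ∈ maximalIdeal R)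
    (hrs : IsWeaklyRegular (R ⧸ I) rs) :
    ((rs.length + zs.length : ℕ) : WithBot ℕ∞) ≤ ringKrullDim R := by
  have hnt : Nontrivial (R ⧸ I) := Ideal.Quotient.nontrivial_iff.mpr hI
  obtain ⟨P, hP⟩ := associatedPrimes.nonempty R (R ⧸ I)
  obtain ⟨a, -, rfl⟩ := Ideal.exists_colon_singleton_eq_of_isAssociatedPrime hP
  have hle : Ideal.ofList zs ≤ I.colon {a} := hzI.trans Ideal.le_colon
  have h1 := hrs.length_le_ringKrullDim_quotient_of_mem_associatedPrimes rs hm _ _ hP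
  have h2 := ringKrullDim_le_of_surjective (Ideal.Quotient.factor hle)
    (Ideal.Quotient.factor_surjective hle)
  rw [← ringKrullDim_add_length_eq_ringKrullDim_of_isRegular zs hzs, Nat.cast_add]
  exact add_le_add_left (h1.trans h2) _

theorem ringKrullDim_eq_length_of_ofList_eq_maximalIdeal {R : Type*} [CommRing R] [IsLocalRing R]
    [IsNoetherianRing R] (ts : List R) (hts : IsRegular R ts)
    (hm : Ideal.ofList ts = maximalIdeal R) : ringKrullDim R = ts.length := by
  rw [← ringKrullDim_add_length_eq_ringKrullDim_of_isRegular ts hts, hm]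
  have h0 : ringKrullDim (R ⧸ maximalIdeal R) = 0 :=
    ringKrullDim_eq_zero_of_field (ResidueField R)
  rw [h0, zero_add]

theorem IsMaximalRegularSequenceIn.supportDim_quotient_add_length {R : Type u} [CommRing R]
    [IsLocalRing R] [IsNoetherianRing R] (ts : List R) (hts : IsRegular R ts)
    (hm : Ideal.ofList ts = maximalIdeal R) {J : Ideal R} (hJ : J ≠ ⊤) {zs : List R}
    (hz : IsMaximalRegularSequenceIn J zs) :
    Module.supportDim R (R ⧸ J) + zs.length = ts.length := by
  have hdim := ringKrullDim_eq_length_of_ofList_eq_maximalIdeal ts hts hm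
  have hzJ : Ideal.ofList zs ≤ J := Ideal.span_le.mpr hz.mem
  have hz1 : Ideal.ofList zs ≠ ⊤ := ne_top_of_le_ne_top hJ hzJ
  rw [Module.supportDim_quotient_eq_ringKrullDim]
  apply le_antisymm
  · rw [← hdim, ← ringKrullDim_add_length_eq_ringKrullDim_of_isRegular zs hz.isRegular]
    exact add_le_add_left (ringKrullDim_le_of_surjective (Ideal.Quotient.factor hzJ)
      (Ideal.Quotient.factor_surjective hzJ)) _
  -- Without such P, some element of J would be regular on R/(z) and prolong z. With it, dim R/J ≥
  -- dim R/P ≥ depth R/(z) = d - `zs.length`.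
  · obtain ⟨P, hP, hJP⟩ : ∃ P ∈ associatedPrimes R (R ⧸ Ideal.ofList zs), J ≤ P := by
      by_contra! hcon
      obtain ⟨x, hxJ, hx⟩ := exists_isSMulRegular_of_forall_associatedPrimes_not_le
        (R ⧸ Ideal.ofList zs) J hcon
      exact hz.maximal x hxJ
        ((isRegular_append_singleton_iff (le_maximalIdeal hJ hxJ)).mpr ⟨hz.isRegular, hx⟩)
    obtain ⟨rs, hrsm, hrs, hpd⟩ :=
      exists_isWeaklyRegular_projectiveDimension_add_length_eq ts hts hm (Ideal.ofList zs) hz1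
    rw [projectiveDimension_quotient_ofList zs hz.isRegular] at hpd
    rw [← hpd, add_comm]
    exact add_le_add_left
      ((hrs.length_le_ringKrullDim_quotient_of_mem_associatedPrimes rs hrsm _ P hP).trans
        (ringKrullDim_le_of_surjective (Ideal.Quotient.factor hJP)
          (Ideal.Quotient.factor_surjective hJP))) _

theorem mainTheorem2 {R : Type*} [CommRing R] [IsRegularLocalRing R]
    (N : ℕ) (J : Ideal R)
    (hJ_gen : ∃ f : Fin N → R, Ideal.span (Set.range f) = J)
    (hJ_height : J.height + 1 = (N : ℕ∞))
    (z : List R) (hz : IsMaximalRegularSequenceIn J z) (hz_length : z.length + 1 = N)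
    (hz_ne : Ideal.ofList z ≠ J) :
    CategoryTheory.projectiveDimension (ModuleCat.of R (R ⧸ J)) ≤
        CategoryTheory.projectiveDimension
          (ModuleCat.of R (R ⧸ (Ideal.ofList z).colon (J : Set R))) + 1 ∧
      (CategoryTheory.projectiveDimension (ModuleCat.of R (R ⧸ J)) =
          CategoryTheory.projectiveDimension
            (ModuleCat.of R (R ⧸ (Ideal.ofList z).colon (J : Set R))) + 1 ↔
        ¬ IsCohenMacaulayModule R (R ⧸ J)) ∧
      (¬ IsCohenMacaulayModule R (R ⧸ J) ↔
        (N : WithBot ℕ∞) ≤ CategoryTheory.projectiveDimension (ModuleCat.of R (R ⧸ J))) := by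
  have hJ : J ≠ ⊤ := by
    rintro rfl
    rw [Ideal.height_top, top_add] at hJ_height
    exact ENat.top_ne_natCast N hJ_height
  obtain ⟨f, hf⟩ := hJ_gen
  have hgen : Ideal.ofList (List.ofFn f) = J := by
    rw [← hf]
    exact congrArg Ideal.span (Set.ext fun x ↦ by simp [List.mem_ofFn])
  have hzJ : Ideal.ofList z ≤ J := Ideal.span_le.mpr hz.mem
  have hI : (Ideal.ofList z).colon (J : Set R) ≠ ⊤ := by
    rw [Ne, Submodule.colon_eq_top_iff_subset]
    exact fun h ↦ hz_ne (le_antisymm hzJ h)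
  obtain ⟨ts, hts, hm⟩ := IsRegularLocalRing.exists_isRegular_ofList_eq_maximalIdeal R
  have hdim := ringKrullDim_eq_length_of_ofList_eq_maximalIdeal ts hts hm
  obtain ⟨rs, p, hrsm, hrs, hp, hprs, hdepth⟩ :=
    exists_projectiveDimension_eq_and_localDepth_eq ts hts hm J hJ
  obtain ⟨ss, q, hssm, hss, hq, hqss, -⟩ :=
    exists_projectiveDimension_eq_and_localDepth_eq ts hts hm _ hI
  have hzp := length_add_length_le_ringKrullDim J hJ z hz.isRegular hzJ rs hrsm hrs
  have hzq := length_add_length_le_ringKrullDim _ hI z hz.isRegular Ideal.le_colon ss hssm hss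
  have hsupp := hz.supportDim_quotient_add_length ts hts hm hJ
  rw [hdim] at hzp hzq
  norm_cast at hzp hzq
  have hCM : IsCohenMacaulayModule R (R ⧸ J) ↔ p = z.length := by
    rw [IsCohenMacaulayModule, hdepth]
    constructor
    · intro h
      rw [← h] at hsupp
      norm_cast at hsupp
      omega
    · intro h
      rw [← hprs, h, Nat.add_comm, Nat.cast_add] at hsupp
      exact le_antisymm (ENat.WithBot.add_le_add_natCast_right_iff.mp hsupp.ge)
        (ENat.WithBot.add_le_add_natCast_right_iff.mp hsupp.le)
  have hpq (n : ℕ) (hn : z.length ≤ n) : p < n + 2 ↔ q < n + 1 := by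
    have := hasProjectiveDimensionLT_quotient_iff_colon J hJ z (List.ofFn f) hz.isRegular hz.mem
      (by simp [hz_length]) hgen n hn
    rw [← projectiveDimension_lt_iff, ← projectiveDimension_lt_iff, hp, hq] at this
    exact_mod_cast this
  -- Taking n = q gives p ≤ q + 1. If p > `z.length`, taking n = p - 1 gives q < p, hence equality;
  -- if p = `z.length`, then p ≤ q.
  have h1 := hpq q (by omega)
  have h2 := hpq (p - 1)
  rw [hp, hq, hCM]
  norm_cast
  omega
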